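/- Let $d\lambda(z)=\frac1\pi e^{-|z|^2}\,dA(z)$ be the Gaussian measure on $\mathbb C$ and let $F^2=L^2(\mathbb C,d\lambda)\cap H(\mathbb C)$ be the Fock space of square-integrable entire functions, with the inner product of $L^2(\mathbb C,d\lambda)$. For $s,t\in\mathbb C$ with $|t|<2|s|$ let $$T^{(s,t)}f(z)=\int_{\mathbb C}\frac1{\sqrt s}\exp\left[\frac{tz^2-\overline{tw^2}+2z\overline w}{2s}\right]f(w)\,d\lambda(w),$$ where $\sqrt{\cdot}$ is the principal square root, $\sqrt s=\sqrt{|s|}\,e^{i\theta/2}$ for $s=|s|e^{i\theta}$, $\theta\in(-\pi,\pi]$. The domain of $T^{(s,t)}$ consists of all $f\in F^2$ for which this integral converges absolutely for every $z$. We call $T^{(s,t)}$ bounded on $F^2$ if it maps its domain into $F^2$ with $\|T^{(s,t)}f\|\le C\|f\|$ for some constant $C$. Then: (i) $T^{(s,t)}$ is bounded on $F^2$ if and only if $|s|^2\ge|t|^2+1$; in that case its domain is all of $F^2$. (ii) $T^{(s,t)}$ is a unitary operator on $F^2$ if and only if $|s|^2=|t|^2+1$; in that case $$[T^{(s,t)}]^{-1}=[T^{(s,t)}]^*=c\,T^{(\bar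 s,-t)},$$ where $c=1$ if $s+|s|\neq0$ and $c=-1$ if $s<0$. (iii) If $|s|^2>|t|^2+1$, then $T^{(s,t)}$ is a Hilbert–Schmidt operator on $F^2$ with Hilbert–Schmidt norm $$\|T^{(s,t)}\|_{S_2}=\frac{\sqrt{|s|}}{\sqrt{|s|^2-|t|^2-1}}.$$ -/

import Mathlib

open MeasureTheory Filter Topology

namespace Fock

/-! ### The Gaussian measure -/

/-- The Gaussian measure `dλ(z) = π⁻¹ exp(-|z|²) dA(z)` on `ℂ`. -/
noncomputable def gaussianMeasure : Measure ℂ :=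
  volume.withDensity fun z => ENNReal.ofReal (Real.exp (-‖z‖ ^ 2) / Real.pi)

theorem measurable_density :
    Measurable fun z : ℂ => ENNReal.ofReal (Real.exp (-‖z‖ ^ 2) / Real.pi) := by
  fun_prop

instance : IsProbabilityMeasure gaussianMeasure := by
  constructor
  have h1 := GaussianFourier.integral_rexp_neg_mul_sq_norm (V := ℂ) (b := 1) one_pos
  have hi : Integrable (fun z : ℂ => Real.exp (-‖z‖ ^ 2)) := by
    by_contra h
    have h2 := integral_undef h
    simp only [neg_mul, one_mul] at h1
    rw [h1] at h2
    simp [Real.pi_ne_zero] at h2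
  rw [gaussianMeasure, withDensity_apply _ MeasurableSet.univ, Measure.restrict_univ,
    ← ofReal_integral_eq_lintegral_ofReal (hi.div_const _)
      (Eventually.of_forall fun z => by positivity), integral_div]
  simp only [neg_mul, one_mul] at h1
  rw [h1]
  simp [Real.pi_ne_zero]

theorem volume_absolutelyContinuous : (volume : Measure ℂ) ≪ gaussianMeasure := by
  refine withDensity_absolutelyContinuous' measurable_density.aemeasurable
    (Eventually.of_forall fun z => ?_)
  have : 0 < Real.exp (-‖z‖ ^ 2) / Real.pi := by positivity
  simpa using this

instance : (gaussianMeasure).IsOpenPosMeasure :=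
  volume_absolutelyContinuous.isOpenPosMeasure

/-- Rotation invariance of the Gaussian measure. -/
theorem measurePreserving_rotation (u : Circle) :
    MeasurePreserving (fun z : ℂ => (u : ℂ) * z) gaussianMeasure gaussianMeasure := by
  have h0 : MeasurePreserving (rotation u) (volume : Measure ℂ) volume :=
    (rotation u).measurePreserving
  have hm : Measurable (fun z : ℂ => (u : ℂ) * z) := by fun_prop
  refine ⟨hm, ?_⟩
  ext A hA
  rw [Measure.map_apply hm hA, gaussianMeasure, withDensity_apply _ (hm hA),
    withDensity_apply _ hA]
  have := h0.setLIntegral_comp_preimage hA measurable_density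
  simp only [LinearIsometryEquiv.norm_map] at this
  exact this

/-- The mean value property of entire functions with respect to the Gaussian measure. -/
theorem integral_eq_apply_zero {g : ℂ → ℂ} (hg : Differentiable ℂ g)
    (hi : Integrable g gaussianMeasure) : ∫ w, g w ∂gaussianMeasure = g 0 := by
  have hc : Continuous g := hg.continuous
  have hrot : ∀ θ : ℝ, ∫ w, g (Circle.exp θ * w) ∂gaussianMeasure
      = ∫ w, g w ∂gaussianMeasure := fun θ =>
    (measurePreserving_rotation (Circle.exp θ)).integral_comp
      (Homeomorph.mulLeft₀ (Circle.exp θ : ℂ) (Circle.coe_ne_zero _)).measurableEmbedding g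
  have hrotn : ∀ θ : ℝ, ∫ w, ‖g (Circle.exp θ * w)‖ ∂gaussianMeasure
      = ∫ w, ‖g w‖ ∂gaussianMeasure := fun θ =>
    (measurePreserving_rotation (Circle.exp θ)).integral_comp
      (Homeomorph.mulLeft₀ (Circle.exp θ : ℂ) (Circle.coe_ne_zero _)).measurableEmbedding
      fun w => ‖g w‖
  have hcirc : ∀ w : ℂ, ∫ θ in Set.Ioc 0 (2 * Real.pi), g (Circle.exp θ * w)
      = (2 * Real.pi : ℝ) • g 0 := by
    intro w
    have hd : Differentiable ℂ fun v : ℂ => g (v * w) :=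
      hg.comp (differentiable_id.mul_const w)
    have h2 : Real.circleAverage (fun v : ℂ => g (v * w)) 0 1 = g (0 * w) :=
      (hd.diffContOnCl (s := Metric.ball 0 |(1 : ℝ)|)).circleAverage
    rw [Real.circleAverage_def, intervalIntegral.integral_of_le Real.two_pi_pos.le] at h2
    simp only [circleMap, Complex.ofReal_one, one_mul, zero_add, zero_mul] at h2
    rw [← h2, smul_smul, mul_inv_cancel₀ Real.two_pi_pos.ne', one_smul]
    simp only [Circle.coe_exp]
  have hprod : Integrable (fun p : ℝ × ℂ => g (Circle.exp p.1 * p.2))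
      ((volume.restrict (Set.Ioc 0 (2 * Real.pi))).prod gaussianMeasure) := by
    rw [integrable_prod_iff (by
      refine Continuous.aestronglyMeasurable ?_
      fun_prop)]
    refine ⟨Eventually.of_forall fun θ => ?_, ?_⟩
    · exact (measurePreserving_rotation (Circle.exp θ)).integrable_comp_of_integrable hi
    · simp only [hrotn]
      exact integrable_const _
  have hswap := integral_integral_swap (f := fun (θ : ℝ) (w : ℂ) => g (Circle.exp θ * w)) hprod
  simp only [hrot, hcirc, integral_const] at hswap
  simpa [Real.pi_pos.le, Real.pi_ne_zero] using hswap

/-! ### The Fock space -/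

/-- The entire functions that are square integrable with respect to the Gaussian measure. -/
noncomputable def fockSubmodule : Submodule ℂ (ℂ → ℂ) where
  carrier := {f | Differentiable ℂ f ∧ MemLp f 2 gaussianMeasure}
  add_mem' hf hg := ⟨hf.1.add hg.1, hf.2.add hg.2⟩
  zero_mem' := ⟨differentiable_const 0, MemLp.zero⟩
  smul_mem' c _ hf := ⟨hf.1.const_smul c, hf.2.const_smul c⟩

end Fock

/-- The Fock space `F² = L²(ℂ, dλ) ∩ H(ℂ)`. -/
def FockSpace : Type := Fock.fockSubmodule

namespace FockSpace

open Fock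

noncomputable instance : AddCommGroup FockSpace := inferInstanceAs (AddCommGroup fockSubmodule)

noncomputable instance : Module ℂ FockSpace := inferInstanceAs (Module ℂ fockSubmodule)

instance : CoeFun FockSpace fun _ => ℂ → ℂ := ⟨fun f => f.1⟩

theorem coe_add (f g : FockSpace) : (f + g).1 = f.1 + g.1 := rfl

theorem coe_sub (f g : FockSpace) : (f - g).1 = f.1 - g.1 := rfl

/-- The inclusion of the Fock space in `L²(ℂ, dλ)`. -/
noncomputable def toL2 : FockSpace →ₗ[ℂ] Lp ℂ 2 gaussianMeasure where
  toFun f := f.2.2.toLp f.1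
  map_add' f g := MemLp.toLp_add f.2.2 g.2.2
  map_smul' c f := MemLp.toLp_const_smul c f.2.2

theorem toL2_injective : Function.Injective toL2 := by
  intro f g h
  have h1 : f.1 =ᵐ[gaussianMeasure] g.1 := (MemLp.toLp_eq_toLp_iff f.2.2 g.2.2).1 h
  exact Subtype.ext ((Continuous.ae_eq_iff_eq _ f.2.1.continuous g.2.1.continuous).1 h1)

/-- The norm inherited from `L²(ℂ, dλ)`. -/
noncomputable instance : NormedAddCommGroup FockSpace :=
  NormedAddCommGroup.induced FockSpace (Lp ℂ 2 gaussianMeasure) toL2 toL2_injective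

theorem norm_toL2 (f : FockSpace) : ‖toL2 f‖ = ‖f‖ := rfl

/-- The inner product inherited from `L²(ℂ, dλ)`. -/
noncomputable instance : InnerProductSpace ℂ FockSpace where
  norm_smul_le c f := by
    rw [← norm_toL2, ← norm_toL2, map_smul, norm_smul]
  inner f g := inner ℂ (toL2 f) (toL2 g)
  norm_sq_eq_re_inner f := by
    rw [← norm_toL2]
    exact norm_sq_eq_re_inner (𝕜 := ℂ) (toL2 f)
  conj_inner_symm f g := inner_conj_symm (toL2 f) (toL2 g)
  add_left f g h := by
    simp only [map_add]
    exact inner_add_left _ _ _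
  smul_left f g c := by
    simp only [map_smul]
    exact inner_smul_left _ _ _

theorem inner_eq_integral (f g : FockSpace) :
    inner ℂ f g = ∫ z, (starRingEnd ℂ) (f z) * g z ∂gaussianMeasure := by
  change inner ℂ (toL2 f) (toL2 g) = _
  rw [L2.inner_def]
  refine integral_congr_ae ?_
  filter_upwards [f.2.2.coeFn_toLp, g.2.2.coeFn_toLp] with z hf hg
  change inner ℂ ((f.2.2.toLp f.1 : ℂ → ℂ) z) ((g.2.2.toLp g.1 : ℂ → ℂ) z) = _
  rw [hf, hg, RCLike.inner_apply, mul_comm]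

theorem norm_sq_eq_integral (f : FockSpace) :
    ‖f‖ ^ 2 = ∫ z, ‖f z‖ ^ 2 ∂gaussianMeasure := by
  have h := inner_eq_integral f f
  rw [inner_self_eq_norm_sq_to_K] at h
  have h2 : ∀ z, (starRingEnd ℂ) (f z) * f z = ((‖f z‖ ^ 2 : ℝ) : ℂ) := fun z => by
    rw [mul_comm, Complex.mul_conj, Complex.normSq_eq_norm_sq]
  simp only [h2] at h
  rw [integral_complex_ofReal] at h
  refine Complex.ofReal_injective ?_
  rw [← h]
  push_cast
  rfl

/-- The element of the Fock space given by a square integrable entire function. -/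
def mk (g : ℂ → ℂ) (hd : Differentiable ℂ g) (hL : MemLp g 2 gaussianMeasure) : FockSpace :=
  ⟨g, hd, hL⟩

/-- Point evaluations are bounded on the Fock space. -/
theorem norm_apply_le (f : FockSpace) (z : ℂ) : ‖f z‖ ≤ Real.exp (‖z‖ ^ 2 / 2) * ‖f‖ := by
  set g : ℂ → ℂ := fun w => f (z + w) * Complex.exp (-(starRingEnd ℂ z * w)) with hgdef
  have hfd : Differentiable ℂ f.1 := f.2.1
  have hgd : Differentiable ℂ g := by
    refine Differentiable.mul (hfd.comp (differentiable_id.const_add z)) ?_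
    fun_prop
  have hpt : ∀ w : ℂ, (Real.exp (-‖w‖ ^ 2) / Real.pi) * ‖g w‖ ^ 2
      = Real.exp (‖z‖ ^ 2) * ((Real.exp (-‖z + w‖ ^ 2) / Real.pi) * ‖f (z + w)‖ ^ 2) := by
    intro w
    have hn : ‖z + w‖ ^ 2 = ‖z‖ ^ 2 + ‖w‖ ^ 2 + 2 * (starRingEnd ℂ z * w).re := by
      rw [← Complex.normSq_eq_norm_sq, ← Complex.normSq_eq_norm_sq, ← Complex.normSq_eq_norm_sq,
        Complex.normSq_add]
      simp only [Complex.mul_re, Complex.conj_re, Complex.conj_im]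
      ring
    simp only [hgdef, norm_mul, Complex.norm_exp, mul_pow, Complex.neg_re]
    rw [hn, ← Real.exp_nat_mul]
    have : Real.exp (‖z‖ ^ 2) * Real.exp
        (-(‖z‖ ^ 2 + ‖w‖ ^ 2 + 2 * (starRingEnd ℂ z * w).re))
        = Real.exp (-‖w‖ ^ 2) * Real.exp ((2 : ℕ) * -(starRingEnd ℂ z * w).re) := by
      rw [← Real.exp_add, ← Real.exp_add]
      congr 1
      push_cast
      ring
    linear_combination (-‖f (z + w)‖ ^ 2 / Real.pi) * this
  have hdens : ∀ (h : ℂ → ℝ), ∫ w, h w ∂gaussianMeasure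
      = ∫ w, (Real.exp (-‖w‖ ^ 2) / Real.pi) * h w := by
    intro h
    rw [gaussianMeasure, integral_withDensity_eq_integral_toReal_smul measurable_density
      (Eventually.of_forall fun _ => ENNReal.ofReal_lt_top)]
    refine integral_congr_ae (Eventually.of_forall fun w => ?_)
    have : 0 ≤ Real.exp (-‖w‖ ^ 2) / Real.pi := by positivity
    simp only [smul_eq_mul]
    rw [ENNReal.toReal_ofReal this]
  have hdensi : ∀ (h : ℂ → ℝ), Integrable h gaussianMeasure
      ↔ Integrable (fun w => (Real.exp (-‖w‖ ^ 2) / Real.pi) * h w) := by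
    intro h
    rw [gaussianMeasure, integrable_withDensity_iff_integrable_smul' measurable_density
      (Eventually.of_forall fun _ => ENNReal.ofReal_lt_top)]
    refine integrable_congr (Eventually.of_forall fun w => ?_)
    have : 0 ≤ Real.exp (-‖w‖ ^ 2) / Real.pi := by positivity
    simp only [smul_eq_mul]
    rw [ENNReal.toReal_ofReal this]
  have hf2 : Integrable (fun w => ‖f w‖ ^ 2) gaussianMeasure :=
    (memLp_two_iff_integrable_sq_norm hfd.continuous.aestronglyMeasurable).1 f.2.2
  have hg2 : Integrable (fun w => ‖g w‖ ^ 2) gaussianMeasure := by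
    rw [hdensi]
    simp only [hpt]
    exact (((hdensi _).1 hf2).comp_add_left z).const_mul _
  have hgL : MemLp g 2 gaussianMeasure :=
    (memLp_two_iff_integrable_sq_norm hgd.continuous.aestronglyMeasurable).2 hg2
  have hnorm : ∫ w, ‖g w‖ ^ 2 ∂gaussianMeasure = Real.exp (‖z‖ ^ 2) * ‖f‖ ^ 2 := by
    rw [norm_sq_eq_integral, hdens, hdens]
    simp only [hpt]
    rw [integral_const_mul,
      integral_add_left_eq_self (fun w => (Real.exp (-‖w‖ ^ 2) / Real.pi) * ‖f w‖ ^ 2) z]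
  have hgi : Integrable g gaussianMeasure := hgL.integrable (by norm_num)
  have h0 : f z = ∫ w, g w ∂gaussianMeasure := by
    rw [integral_eq_apply_zero hgd hgi]
    simp [hgdef]
  let G : FockSpace := mk g hgd hgL
  let one : FockSpace := mk (fun _ => 1) (differentiable_const _) (memLp_const _)
  have h1 : ‖one‖ = 1 := by
    have := norm_sq_eq_integral one
    have h2 : ‖one‖ ^ 2 = 1 := by
      rw [this]
      simp [one, mk]
    nlinarith [norm_nonneg one]
  have hG : ‖G‖ ^ 2 = Real.exp (‖z‖ ^ 2) * ‖f‖ ^ 2 := by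
    rw [norm_sq_eq_integral]
    exact hnorm
  have hin : inner ℂ one G = f z := by
    rw [inner_eq_integral, h0]
    simp [one, G, mk]
  have hcs := norm_inner_le_norm (𝕜 := ℂ) one G
  rw [hin, h1, one_mul] at hcs
  refine hcs.trans (abs_le_of_sq_le_sq' ?_ (by positivity)).2
  rw [hG, mul_pow, ← Real.exp_nat_mul]
  apply le_of_eq
  congr 2
  push_cast
  ring

/-- The Fock space is complete, hence a Hilbert space. -/
instance : CompleteSpace FockSpace := by
  refine Metric.complete_of_cauchySeq_tendsto fun u hu => ?_
  have hpt : ∀ m n z, ‖u m z - u n z‖ ≤ Real.exp (‖z‖ ^ 2 / 2) * ‖u m - u n‖ := fun m n z =>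
    norm_apply_le (u m - u n) z
  have hcau : ∀ ε > 0, ∃ N, ∀ m ≥ N, ∀ n ≥ N, ‖u m - u n‖ < ε := by
    intro ε hε
    obtain ⟨N, hN⟩ := Metric.cauchySeq_iff.1 hu ε hε
    exact ⟨N, fun m hm n hn => by simpa [dist_eq_norm] using hN m hm n hn⟩
  have hex : ∀ z, ∃ l, Tendsto (fun n => u n z) atTop (𝓝 l) := by
    intro z
    refine cauchySeq_tendsto_of_complete (Metric.cauchySeq_iff.2 fun ε hε => ?_)
    obtain ⟨N, hN⟩ := hcau (ε / Real.exp (‖z‖ ^ 2 / 2)) (by positivity)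
    refine ⟨N, fun m hm n hn => ?_⟩
    rw [dist_eq_norm]
    refine (hpt m n z).trans_lt ?_
    have := hN m hm n hn
    rw [lt_div_iff₀ (Real.exp_pos _)] at this
    linarith
  choose g hg using hex
  have hunif : TendstoLocallyUniformlyOn (fun n z => u n z) g atTop Set.univ := by
    rw [tendstoLocallyUniformlyOn_iff_forall_isCompact isOpen_univ]
    intro K _ hK
    obtain ⟨R, hR⟩ := hK.isBounded.exists_norm_le
    rw [Metric.tendstoUniformlyOn_iff]
    intro ε hε
    obtain ⟨N, hN⟩ := hcau (ε / 2 / Real.exp (R ^ 2 / 2)) (by positivity)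
    filter_upwards [eventually_ge_atTop N] with n hn z hz
    have hle : dist (g z) (u n z) ≤ ε / 2 := by
      refine le_of_tendsto ((hg z).dist tendsto_const_nhds) ?_
      filter_upwards [eventually_ge_atTop N] with m hm
      rw [dist_eq_norm]
      refine (hpt m n z).trans ?_
      have h1 := (hN m hm n hn).le
      rw [le_div_iff₀ (Real.exp_pos _)] at h1
      have h2 : Real.exp (‖z‖ ^ 2 / 2) ≤ Real.exp (R ^ 2 / 2) := by
        have := hR z hz
        gcongr
      nlinarith [norm_nonneg (u m - u n)]
    linarith
  have hgd : Differentiable ℂ g := by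
    rw [← differentiableOn_univ]
    exact hunif.differentiableOn
      (Eventually.of_forall fun n => (u n).2.1.differentiableOn) isOpen_univ
  have huL : CauchySeq fun n => toL2 (u n) := by
    refine Metric.cauchySeq_iff.2 fun ε hε => ?_
    obtain ⟨N, hN⟩ := hcau ε hε
    refine ⟨N, fun m hm n hn => ?_⟩
    rw [dist_eq_norm, ← map_sub, norm_toL2]
    exact hN m hm n hn
  obtain ⟨h, hh⟩ := cauchySeq_tendsto_of_complete huL
  have hae : (h : ℂ → ℂ) =ᵐ[gaussianMeasure] g := by
    obtain ⟨φ, hφ, hφt⟩ := (tendstoInMeasure_of_tendsto_Lp hh).exists_seq_tendsto_ae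
    have hall : ∀ᵐ z ∂gaussianMeasure, ∀ n, (toL2 (u n) : ℂ → ℂ) z = u n z :=
      ae_all_iff.2 fun n => (u n).2.2.coeFn_toLp
    filter_upwards [hφt, hall] with z h1 h2
    simp only [h2] at h1
    exact tendsto_nhds_unique h1 ((hg z).comp hφ.tendsto_atTop)
  have hgL : MemLp g 2 gaussianMeasure := (memLp_congr_ae hae).1 (Lp.memLp h)
  refine ⟨mk g hgd hgL, ?_⟩
  have hG : toL2 (mk g hgd hgL) = h := Lp.ext ((hgL.coeFn_toLp).trans hae.symm)
  rw [tendsto_iff_norm_sub_tendsto_zero] at hh ⊢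
  refine hh.congr fun n => ?_
  rw [← hG, ← map_sub, norm_toL2]

end FockSpace

/-! ### The integral operators -/

namespace Fock

/-- The kernel `K^{(s,t)}(z,w) = (√s)⁻¹ exp[(t z² - conj(t w²) + 2 z conj(w)) / (2s)]`, with the
principal square root. -/
noncomputable def kernel (s t z w : ℂ) : ℂ :=
  1 / Complex.sqrt s * Complex.exp
    ((t * z ^ 2 - (starRingEnd ℂ) (t * w ^ 2) + 2 * z * (starRingEnd ℂ) w) / (2 * s))

/-- The integral `T^{(s,t)} f(z) = ∫ K^{(s,t)}(z,w) f(w) dλ(w)`. -/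
noncomputable def transform (s t : ℂ) (f : ℂ → ℂ) (z : ℂ) : ℂ :=
  ∫ w, kernel s t z w * f w ∂gaussianMeasure

/-- The integral defining `T^{(s,t)} f(z)` converges absolutely for every `z`. -/
def InDomain (s t : ℂ) (f : ℂ → ℂ) : Prop :=
  ∀ z, Integrable (fun w => kernel s t z w * f w) gaussianMeasure

/-- `T^{(s,t)}` is bounded on `F²`: it maps those `f ∈ F²` for which the defining integral
converges into `F²`, with a uniform bound on the norm. -/
def IsBounded (s t : ℂ) : Prop :=
  ∃ C : ℝ, ∀ f : FockSpace, InDomain s t f →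
    ∃ g : FockSpace, (∀ z, g z = transform s t f z) ∧ ‖g‖ ≤ C * ‖f‖

/-- `A` is the operator `T^{(s,t)}`, everywhere defined and bounded on `F²`. -/
def IsOperator (s t : ℂ) (A : FockSpace →L[ℂ] FockSpace) : Prop :=
  ∀ f : FockSpace, InDomain s t f ∧ ∀ z, A f z = transform s t f z

/-- The bounded operator `A` on a Hilbert space is of Hilbert-Schmidt class with Hilbert-Schmidt
norm `r`: for every orthonormal basis `b` one has `∑ ‖A bᵢ‖² = r²`. -/
def HasHilbertSchmidtNorm.{u} {H : Type u} [NormedAddCommGroup H] [InnerProductSpace ℂ H]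
    (A : H →L[ℂ] H) (r : ℝ) : Prop :=
  0 ≤ r ∧ ∀ (ι : Type u) (b : HilbertBasis ι ℂ H), HasSum (fun i => ‖A (b i)‖ ^ 2) (r ^ 2)

open Classical in
/-- The sign `c = 1` when `s + |s| ≠ 0`, and `c = -1` when `s < 0`. -/
noncomputable def sign (s : ℂ) : ℂ := if s + (‖s‖ : ℂ) ≠ 0 then 1 else -1

end Fock

namespace Fock

open ComplexConjugate

/-! ### Gaussian integrals over the complex plane -/

/-- The exponential of the quadratic polynomial `-p|z|² + Re (b z²) + c z + d conj z`. -/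
noncomputable def quadExp (p : ℝ) (b c d z : ℂ) : ℂ :=
  Complex.exp (-(p * (z * conj z)) + (b * z ^ 2 + conj b * conj z ^ 2) / 2 + c * z + d * conj z)

theorem integral_exp_neg_quadratic {a : ℝ} (ha : 0 < a) (c : ℂ) :
    ∫ x : ℝ, Complex.exp (-a * x ^ 2 + c * x + 0)
      = (√(Real.pi / a) : ℝ) * Complex.exp (c ^ 2 / (4 * a)) := by
  rw [integral_cexp_quadratic (by simpa using ha), Real.sqrt_eq_rpow,
    Complex.ofReal_cpow (by positivity)]
  congr 2
  · push_cast
    rw [neg_neg]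
  · push_cast
    rfl
  · rw [mul_neg, div_neg]
    ring

theorem quadExp_ofReal_apply (p β : ℝ) (c d : ℂ) (q : ℝ × ℝ) :
    quadExp p β c d (Complex.measurableEquivRealProd.symm q)
      = Complex.exp (-(p - β : ℝ) * q.1 ^ 2 + (c + d) * q.1 + 0)
        * Complex.exp (-(p + β : ℝ) * q.2 ^ 2 + (Complex.I * (c - d)) * q.2 + 0) := by
  have hz : Complex.measurableEquivRealProd.symm q = q.1 + q.2 * Complex.I :=
    Complex.mk_eq_add_mul_I _ _
  rw [hz, quadExp, ← Complex.exp_add]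
  congr 1
  simp only [map_add, map_mul, Complex.conj_ofReal, Complex.conj_I]
  push_cast
  linear_combination (-(p : ℂ) * q.2 ^ 2 * -1 + β * q.2 ^ 2) * Complex.I_sq

theorem integrable_quadExp_ofReal {p β : ℝ} (h : |β| < p) (c d : ℂ) :
    Integrable (quadExp p β c d) := by
  rw [abs_lt] at h
  rw [← Complex.volume_preserving_equiv_real_prod.symm.integrable_comp_emb
    Complex.measurableEquivRealProd.symm.measurableEmbedding]
  have h1 : 0 < p - β := by linarith
  have h2 : 0 < p + β := by linarith
  refine ((integrable_cexp_quadratic' (b := -(p - β : ℝ)) (by simpa using h1) (c + d) 0).mul_prod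
    (integrable_cexp_quadratic' (b := -(p + β : ℝ))
      (by rwa [Complex.neg_re, Complex.ofReal_re, neg_lt_zero])
      (Complex.I * (c - d)) 0)).congr (Eventually.of_forall fun q => ?_)
  exact (quadExp_ofReal_apply p β c d q).symm

theorem integral_quadExp_ofReal {p β : ℝ} (h : |β| < p) (c d : ℂ) :
    ∫ z, quadExp p β c d z = (Real.pi / √(p ^ 2 - β ^ 2) : ℝ)
      * Complex.exp ((p * c * d + β * (c ^ 2 + d ^ 2) / 2) / (p ^ 2 - β ^ 2 : ℝ)) := by
  rw [abs_lt] at h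
  have h1 : 0 < p - β := by linarith
  have h2 : 0 < p + β := by linarith
  rw [← Complex.volume_preserving_equiv_real_prod.symm.integral_comp
    Complex.measurableEquivRealProd.symm.measurableEmbedding]
  simp_rw [quadExp_ofReal_apply]
  rw [Measure.volume_eq_prod, integral_prod_mul
    (fun x : ℝ => Complex.exp (-(p - β : ℝ) * x ^ 2 + (c + d) * x + 0))
    (fun y : ℝ => Complex.exp (-(p + β : ℝ) * y ^ 2 + (Complex.I * (c - d)) * y + 0)),
    integral_exp_neg_quadratic h1, integral_exp_neg_quadratic h2, mul_mul_mul_comm,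
    ← Complex.exp_add, ← Complex.ofReal_mul, ← Real.sqrt_mul (by positivity)]
  congr 2
  · rw [div_mul_div_comm, Real.sqrt_div (by positivity), Real.sqrt_mul_self Real.pi_pos.le]
    ring_nf
  · have e1 : ((p : ℂ) - β) ≠ 0 := by exact_mod_cast h1.ne'
    have e2 : ((p : ℂ) + β) ≠ 0 := by exact_mod_cast h2.ne'
    have e3 : ((p : ℂ) ^ 2 - β ^ 2) ≠ 0 := by
      rw [sq_sub_sq]
      exact mul_ne_zero e2 e1
    push_cast
    rw [mul_pow, Complex.I_sq]
    field_simp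
    ring

theorem exists_circle_mul_sq (b : ℂ) : ∃ u : Circle, b * (u : ℂ) ^ 2 = ‖b‖ := by
  refine ⟨Circle.exp (-(b.arg / 2)), ?_⟩
  rw [Circle.coe_exp, ← Complex.exp_nat_mul]
  nth_rewrite 1 [← Complex.norm_mul_exp_arg_mul_I b]
  rw [mul_assoc, ← Complex.exp_add]
  push_cast
  ring_nf
  simp

theorem quadExp_rotate {b : ℂ} {u : Circle} (hu : b * (u : ℂ) ^ 2 = ‖b‖) (p : ℝ) (c d z : ℂ) :
    quadExp p b c d (rotation u z) = quadExp p (‖b‖ : ℝ) (c * u) (d * conj (u : ℂ)) z := by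
  have h1 : (u : ℂ) * conj (u : ℂ) = 1 := by
    rw [Complex.mul_conj, Circle.normSq_coe, Complex.ofReal_one]
  have h2 : conj b * conj (u : ℂ) ^ 2 = ‖b‖ := by
    rw [← map_pow, ← map_mul, hu, Complex.conj_ofReal]
  rw [rotation_apply, quadExp, quadExp]
  congr 1
  simp only [map_mul, Complex.conj_ofReal]
  linear_combination -(p : ℂ) * z * conj z * h1 + z ^ 2 / 2 * hu + conj z ^ 2 / 2 * h2

theorem integrable_quadExp {p : ℝ} {b : ℂ} (h : ‖b‖ < p) (c d : ℂ) :
    Integrable (quadExp p b c d) := by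
  obtain ⟨u, hu⟩ := exists_circle_mul_sq b
  rw [← (rotation u).measurePreserving.integrable_comp_emb
    (rotation u).toHomeomorph.measurableEmbedding]
  refine (integrable_quadExp_ofReal (p := p) (β := ‖b‖) (by simpa using h) (c * u)
    (d * conj (u : ℂ))).congr (Eventually.of_forall fun z => ?_)
  exact (quadExp_rotate hu p c d z).symm

theorem integral_quadExp {p : ℝ} {b : ℂ} (h : ‖b‖ < p) (c d : ℂ) :
    ∫ z, quadExp p b c d z = (Real.pi / √(p ^ 2 - ‖b‖ ^ 2) : ℝ)
      * Complex.exp ((p * c * d + (conj b * c ^ 2 + b * d ^ 2) / 2) / (p ^ 2 - ‖b‖ ^ 2 : ℝ)) := by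
  obtain ⟨u, hu⟩ := exists_circle_mul_sq b
  rw [← (rotation u).measurePreserving.integral_comp
    (rotation u).toHomeomorph.measurableEmbedding]
  simp_rw [quadExp_rotate hu]
  rw [integral_quadExp_ofReal (by simpa using h)]
  have h1 : (u : ℂ) * conj (u : ℂ) = 1 := by
    rw [Complex.mul_conj, Circle.normSq_coe, Complex.ofReal_one]
  have h2 : conj b * conj (u : ℂ) ^ 2 = ‖b‖ := by
    rw [← map_pow, ← map_mul, hu, Complex.conj_ofReal]
  congr 3
  linear_combination (p : ℂ) * c * d * h1 - c ^ 2 / 2 * (u : ℂ) ^ 2 * h2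
    - d ^ 2 / 2 * conj (u : ℂ) ^ 2 * hu
    + (conj b * c ^ 2 + b * d ^ 2) / 2 * (u * conj (u : ℂ) + 1) * h1

theorem integral_gaussianMeasure {E : Type*} [NormedAddCommGroup E] [NormedSpace ℝ E] (h : ℂ → E) :
    ∫ w, h w ∂gaussianMeasure = ∫ w, (Real.exp (-‖w‖ ^ 2) / Real.pi) • h w := by
  rw [gaussianMeasure, integral_withDensity_eq_integral_toReal_smul measurable_density
    (Eventually.of_forall fun _ => ENNReal.ofReal_lt_top)]
  refine integral_congr_ae (Eventually.of_forall fun w => ?_)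
  have : 0 ≤ Real.exp (-‖w‖ ^ 2) / Real.pi := by positivity
  simp only
  rw [ENNReal.toReal_ofReal this]

theorem integrable_gaussianMeasure_iff {E : Type*} [NormedAddCommGroup E] [NormedSpace ℝ E]
    (h : ℂ → E) : Integrable h gaussianMeasure
      ↔ Integrable (fun w => (Real.exp (-‖w‖ ^ 2) / Real.pi) • h w) := by
  rw [gaussianMeasure, integrable_withDensity_iff_integrable_smul' measurable_density
    (Eventually.of_forall fun _ => ENNReal.ofReal_lt_top)]
  refine integrable_congr (Eventually.of_forall fun w => ?_)
  have : 0 ≤ Real.exp (-‖w‖ ^ 2) / Real.pi := by positivity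
  simp only
  rw [ENNReal.toReal_ofReal this]

theorem density_smul_quadExp (p : ℝ) (b c d w : ℂ) :
    (Real.exp (-‖w‖ ^ 2) / Real.pi) • quadExp p b c d w
      = (Real.pi : ℂ)⁻¹ * quadExp (p + 1) b c d w := by
  rw [Complex.real_smul, Complex.ofReal_div, Complex.ofReal_exp, quadExp, quadExp, div_eq_inv_mul,
    mul_assoc, ← Complex.exp_add]
  congr 2
  rw [Complex.mul_conj, Complex.normSq_eq_norm_sq]
  push_cast
  ring

theorem integrable_quadExp_gaussianMeasure {p : ℝ} {b : ℂ} (h : ‖b‖ < p + 1) (c d : ℂ) :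
    Integrable (quadExp p b c d) gaussianMeasure := by
  rw [integrable_gaussianMeasure_iff]
  simp_rw [density_smul_quadExp]
  exact (integrable_quadExp h c d).const_mul _

theorem integral_quadExp_gaussianMeasure {p : ℝ} {b : ℂ} (h : ‖b‖ < p + 1) (c d : ℂ) :
    ∫ z, quadExp p b c d z ∂gaussianMeasure = ((√((p + 1) ^ 2 - ‖b‖ ^ 2))⁻¹ : ℝ)
      * Complex.exp (((p + 1) * c * d + (conj b * c ^ 2 + b * d ^ 2) / 2)
        / ((p + 1) ^ 2 - ‖b‖ ^ 2 : ℝ)) := by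
  rw [integral_gaussianMeasure]
  simp_rw [density_smul_quadExp]
  rw [integral_const_mul, integral_quadExp h, ← mul_assoc]
  congr 2
  · have : (Real.pi : ℂ) ≠ 0 := by exact_mod_cast Real.pi_ne_zero
    push_cast
    field_simp
  · push_cast
    rfl

theorem integrable_exp_quadratic {τ : ℂ} (h : ‖τ‖ < 2) (c d : ℂ) :
    Integrable (fun w => Complex.exp (τ / 2 * w ^ 2 + c * w + d * conj w)) gaussianMeasure := by
  refine (integrable_quadExp_gaussianMeasure (p := 0) (b := τ / 2) (by
    rw [norm_div, RCLike.norm_ofNat]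
    linarith) c d).mono (by fun_prop) (Eventually.of_forall fun w => le_of_eq ?_)
  rw [quadExp, Complex.norm_exp, Complex.norm_exp, ← map_pow, ← map_mul, Complex.add_conj]
  congr 1
  simp

/-! ### The reproducing property -/

theorem exp_sub_mul_density (a v : ℂ) (x : ℂ) :
    (Real.exp (-‖a + v‖ ^ 2) / Real.pi) • (x * Complex.exp (a * conj (a + v)))
      = (Real.exp (-‖v‖ ^ 2) / Real.pi) • (x * Complex.exp (-(conj a * v))) := by
  have h : Complex.exp ((-‖a + v‖ ^ 2 : ℝ) : ℂ) * Complex.exp (a * conj (a + v))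
      = Complex.exp ((-‖v‖ ^ 2 : ℝ) : ℂ) * Complex.exp (-(conj a * v)) := by
    rw [← Complex.exp_add, ← Complex.exp_add]
    congr 1
    rw [← Complex.normSq_eq_norm_sq, ← Complex.normSq_eq_norm_sq]
    push_cast
    rw [← Complex.mul_conj, ← Complex.mul_conj, map_add]
    ring
  simp only [Complex.real_smul, Complex.ofReal_div, Complex.ofReal_exp]
  linear_combination (x / Real.pi) * h

theorem integral_mul_exp_conj {F : ℂ → ℂ} (hF : Differentiable ℂ F) (a : ℂ)
    (hi : Integrable (fun w => F w * Complex.exp (a * conj w)) gaussianMeasure) :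
    ∫ w, F w * Complex.exp (a * conj w) ∂gaussianMeasure = F a := by
  set g : ℂ → ℂ := fun v => F (a + v) * Complex.exp (-(conj a * v)) with hg
  have hgd : Differentiable ℂ g := by
    refine Differentiable.mul (hF.comp (differentiable_id.const_add a)) ?_
    fun_prop
  have hgi : Integrable g gaussianMeasure := by
    rw [integrable_gaussianMeasure_iff] at hi ⊢
    refine (hi.comp_add_left a).congr (Eventually.of_forall fun v => ?_)
    exact exp_sub_mul_density a v _
  have h0 : ∫ w, g w ∂gaussianMeasure = F a := by
    rw [integral_eq_apply_zero hgd hgi]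
    simp [hg]
  rw [← h0, integral_gaussianMeasure, integral_gaussianMeasure, ← integral_add_left_eq_self _ a]
  exact integral_congr_ae (Eventually.of_forall fun v => exp_sub_mul_density a v _)

end Fock

namespace FockSpace

open Fock ComplexConjugate

theorem differentiable (f : FockSpace) : Differentiable ℂ f.1 := f.2.1

theorem memLp (f : FockSpace) : MemLp f.1 2 gaussianMeasure := f.2.2

theorem integrable_norm_sq (f : FockSpace) : Integrable (fun z => ‖f z‖ ^ 2) gaussianMeasure :=
  (memLp_two_iff_integrable_sq_norm f.differentiable.continuous.aestronglyMeasurable).1 f.memLp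

theorem ext_apply {f g : FockSpace} (h : ∀ z, f z = g z) : f = g :=
  Subtype.ext (funext h)

theorem smul_apply (c : ℂ) (f : FockSpace) (z : ℂ) : (c • f) z = c * f z := rfl

theorem integrable_conj_mul (f g : FockSpace) :
    Integrable (fun w => conj (f w) * g w) gaussianMeasure := by
  refine MemLp.integrable_mul (p := 2) (q := 2) (f.memLp.norm.of_le ?_ ?_) g.memLp
  · exact (Complex.continuous_conj.comp f.differentiable.continuous).aestronglyMeasurable
  · exact Eventually.of_forall fun w => by simp

theorem memLp_exp_quadratic {τ : ℂ} (h : ‖τ‖ < 1) (η : ℂ) :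
    MemLp (fun w => Complex.exp (τ / 2 * w ^ 2 + η * w)) 2 gaussianMeasure := by
  rw [memLp_two_iff_integrable_sq_norm
    (Continuous.aestronglyMeasurable (by fun_prop))]
  have h2 : ‖2 * τ‖ < 2 := by
    rw [norm_mul, RCLike.norm_ofNat]
    linarith
  refine (integrable_exp_quadratic h2 (2 * η) 0).norm.congr (Eventually.of_forall fun w => ?_)
  simp only
  rw [← norm_pow, ← Complex.exp_nat_mul]
  congr 2
  push_cast
  ring

/-- The function `exp (τ w² / 2 + η w)`, for `|τ| < 1`. -/
noncomputable def gaussian (τ η : ℂ) (h : ‖τ‖ < 1) : FockSpace :=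
  mk (fun w => Complex.exp (τ / 2 * w ^ 2 + η * w)) (by fun_prop) (memLp_exp_quadratic h η)

theorem gaussian_apply (τ η : ℂ) (h : ‖τ‖ < 1) (w : ℂ) :
    gaussian τ η h w = Complex.exp (τ / 2 * w ^ 2 + η * w) := rfl

theorem inner_gaussian (τ η' η : ℂ) (h : ‖τ‖ < 1) :
    inner ℂ (gaussian τ η' h) (gaussian τ η h) = ((√(1 - ‖τ‖ ^ 2))⁻¹ : ℝ)
      * Complex.exp ((η * conj η' + (conj τ * η ^ 2 + τ * conj η' ^ 2) / 2)
        / (1 - ‖τ‖ ^ 2 : ℝ)) := by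
  have hq := integral_quadExp_gaussianMeasure (p := 0) (b := τ) (by simpa using h) η (conj η')
  rw [inner_eq_integral]
  simp only [zero_add, one_pow, Complex.ofReal_zero, one_mul] at hq
  rw [← hq]
  refine integral_congr_ae (Eventually.of_forall fun w => ?_)
  simp only [gaussian_apply]
  rw [← Complex.exp_conj, ← Complex.exp_add, quadExp]
  congr 1
  simp only [map_add, map_mul, map_pow, map_div₀, map_ofNat]
  push_cast
  ring

/-- The coherent state `w ↦ exp (w conj a)`. -/
noncomputable def coherent (a : ℂ) : FockSpace := gaussian 0 (conj a) (by simp)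

theorem coherent_apply (a w : ℂ) : coherent a w = Complex.exp (conj a * w) := by
  rw [coherent, gaussian_apply]
  simp

theorem inner_coherent (a : ℂ) (f : FockSpace) : inner ℂ (coherent a) f = f a := by
  have h : ∀ w, conj (coherent a w) * f w = f w * Complex.exp (a * conj w) := fun w => by
    rw [coherent_apply, ← Complex.exp_conj, map_mul, Complex.conj_conj, mul_comm]
  have hi := integrable_conj_mul (coherent a) f
  rw [inner_eq_integral]
  simp only [h] at hi ⊢
  exact integral_mul_exp_conj f.differentiable a hi

theorem norm_coherent (a : ℂ) : ‖coherent a‖ = Real.exp (‖a‖ ^ 2 / 2) := by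
  refine (pow_left_inj₀ (norm_nonneg _) (Real.exp_pos _).le two_ne_zero).1 ?_
  rw [@norm_sq_eq_re_inner ℂ, inner_coherent, coherent_apply, Complex.conj_mul',
    ← Complex.ofReal_pow, ← Complex.ofReal_exp, ← Real.exp_nat_mul]
  refine (Complex.ofReal_re _).trans (congrArg Real.exp ?_)
  push_cast
  ring

theorem denseRange_linearCombination_coherent :
    DenseRange (Finsupp.linearCombination ℂ coherent) := by
  have h : (Submodule.span ℂ (Set.range coherent)).topologicalClosure = ⊤ := by
    rw [Submodule.topologicalClosure_eq_top_iff, Submodule.eq_bot_iff]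
    intro f hf
    refine ext_apply fun a => ?_
    rw [← inner_coherent]
    exact (Submodule.mem_orthogonal _ _).1 hf _ (Submodule.subset_span ⟨a, rfl⟩)
  rw [← Finsupp.range_linearCombination] at h
  exact dense_iff_closure_eq.2 (congrArg SetLike.coe h)

/-- Orthonormal bases of the Fock space are countable. -/
theorem countable_of_hilbertBasis {ι : Type*} (b : HilbertBasis ι ℂ FockSpace) : Countable ι := by
  obtain ⟨D, hDc, hDd⟩ := TopologicalSpace.exists_countable_dense ℂ
  have hsupp : ∀ z : ℂ, {i | b i z ≠ 0}.Countable := fun z => by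
    have h := (b.summable_inner_mul_inner (coherent z) (coherent z)).countable_support
    refine h.mono fun i hi => ?_
    rw [Function.mem_support, ← inner_conj_symm (b i), inner_coherent]
    exact mul_ne_zero hi ((map_ne_zero _).2 hi)
  rw [← Set.countable_univ_iff]
  refine (hDc.biUnion fun z _ => hsupp z).mono fun i _ => ?_
  by_contra hcon
  simp only [Set.mem_iUnion, Set.mem_ofPred_eq, not_exists, not_not] at hcon
  have h0 : (b i).1 = 0 := Continuous.ext_on hDd (b i).differentiable.continuous
    continuous_const fun z hz => hcon z hz
  have h1 := b.orthonormal.1 i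
  rw [show b i = 0 from Subtype.ext h0, norm_zero] at h1
  exact zero_ne_one h1

end FockSpace

namespace Fock

open ComplexConjugate FockSpace

/-! ### The kernel -/

theorem norm_sqrt (s : ℂ) : ‖Complex.sqrt s‖ = √‖s‖ := by
  refine (pow_left_inj₀ (norm_nonneg _) (Real.sqrt_nonneg _) two_ne_zero).1 ?_
  rw [Real.sq_sqrt (norm_nonneg _), ← norm_pow, Complex.sqrt]
  congr 1
  exact_mod_cast Complex.cpow_nat_inv_pow s two_ne_zero

theorem sign_eq_or (s : ℂ) : sign s = 1 ∨ sign s = -1 := by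
  unfold sign
  split_ifs <;> simp

theorem conj_sign (s : ℂ) : conj (sign s) = sign s := by
  rcases sign_eq_or s with h | h <;> simp [h]

theorem sign_mul_sign (s : ℂ) : sign s * sign s = 1 := by
  rcases sign_eq_or s with h | h <;> simp [h]

theorem sqrt_conj (s : ℂ) (hs : s ≠ 0) :
    Complex.sqrt (conj s) = sign s * conj (Complex.sqrt s) := by
  by_cases h : s.arg = Real.pi
  · have h1 := (Complex.arg_eq_pi_iff).1 h
    have hc : conj s = s := Complex.conj_eq_iff_im.2 h1.2
    have hn : ‖s‖ = -s.re := by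
      rw [← Complex.abs_re_eq_norm.2 h1.2, abs_of_neg h1.1]
    have hsum : s + (‖s‖ : ℂ) = 0 := by
      rw [hn]
      apply Complex.ext <;> simp [h1.2]
    rw [hc, sign, if_neg (not_not.2 hsum), Complex.sqrt_eq_real_add_ite]
    simp [hn, h1.2]
  · have hsum : s + (‖s‖ : ℂ) ≠ 0 := by
      intro h0
      apply h
      rw [eq_neg_of_add_eq_zero_left h0, ← Complex.ofReal_neg]
      exact Complex.arg_ofReal_of_neg (neg_lt_zero.2 (norm_pos_iff.2 hs))
    rw [sign, if_pos hsum, one_mul, Complex.sqrt, Complex.sqrt, Complex.conj_cpow _ _ h, map_inv₀,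
      Complex.conj_ofNat]

/-- The kernels of `T^{(conj s, -t)}` and of the adjoint of `T^{(s,t)}` agree up to sign. -/
theorem kernel_conj_neg (s t : ℂ) (hs : s ≠ 0) (a z : ℂ) :
    kernel (conj s) (-t) a z = sign s * conj (kernel s t z a) := by
  have hinv : 1 / (sign s * conj (Complex.sqrt s)) = sign s * (1 / conj (Complex.sqrt s)) := by
    rw [one_div, mul_inv, inv_eq_of_mul_eq_one_right (sign_mul_sign s), one_div]
  rw [kernel, kernel, sqrt_conj s hs, hinv, map_mul conj (1 / Complex.sqrt s), mul_assoc,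
    map_div₀ conj 1, map_one, ← Complex.exp_conj]
  congr 3
  simp only [map_add, map_sub, map_neg, map_mul, map_pow, map_div₀, map_ofNat, Complex.conj_conj]
  ring

theorem norm_kernel (s t z w : ℂ) : ‖kernel s t z w‖ = (√‖s‖)⁻¹ *
    Real.exp ((t * z ^ 2 - conj (t * w ^ 2) + 2 * z * conj w) / (2 * s)).re := by
  rw [kernel, norm_mul, norm_div, norm_one, norm_sqrt, Complex.norm_exp, one_div]

theorem conj_kernel (s t z w : ℂ) : conj (kernel s t z w)
    = conj (1 / Complex.sqrt s * Complex.exp (t * z ^ 2 / (2 * s)))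
      * Complex.exp (-t / conj s / 2 * w ^ 2 + conj (z / s) * w) := by
  rw [kernel, map_mul conj (1 / Complex.sqrt s), map_mul conj (1 / Complex.sqrt s),
    mul_assoc (conj (1 / Complex.sqrt s)), ← Complex.exp_conj, ← Complex.exp_conj, ← Complex.exp_add]
  congr 2
  simp only [map_add, map_sub, map_mul, map_pow, map_div₀, map_ofNat, Complex.conj_conj]
  ring

theorem differentiable_conj_kernel (s t z : ℂ) :
    Differentiable ℂ fun w => conj (kernel s t z w) := by
  simp_rw [conj_kernel]
  fun_prop

theorem norm_neg_div_conj_lt {s t : ℂ} (h : ‖t‖ < ‖s‖) : ‖-t / conj s‖ < 1 := by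
  rw [norm_div, norm_neg, RCLike.norm_conj]
  exact (div_lt_one ((norm_nonneg t).trans_lt h)).2 h

theorem norm_div_lt {s t : ℂ} (h : ‖t‖ < ‖s‖) : ‖t / s‖ < 1 := by
  rw [norm_div]
  exact (div_lt_one ((norm_nonneg t).trans_lt h)).2 h

/-- The integral against a coherent state converges and evaluates the kernel. -/
theorem integrable_and_transform_coherent {s t : ℂ} (hst : ‖t‖ < 2 * ‖s‖) (a : ℂ) :
    InDomain s t (coherent a) ∧ ∀ z, transform s t (coherent a) z = kernel s t z a := by
  have hs : 0 < ‖s‖ := by linarith [norm_nonneg t]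
  have hconj : ∀ z w, kernel s t z w * coherent a w
      = conj (conj (kernel s t z w) * Complex.exp (a * conj w)) := fun z w => by
    rw [map_mul, Complex.conj_conj, ← Complex.exp_conj, map_mul, Complex.conj_conj, coherent_apply]
  have hi : ∀ z, Integrable (fun w => conj (kernel s t z w) * Complex.exp (a * conj w))
      gaussianMeasure := fun z => by
    have h2 : ‖-t / conj s‖ < 2 := by
      rw [norm_div, norm_neg, RCLike.norm_conj]
      exact (div_lt_iff₀ hs).2 hst
    refine ((integrable_exp_quadratic h2 (conj (z / s)) a).const_mul
      (conj (1 / Complex.sqrt s * Complex.exp (t * z ^ 2 / (2 * s))))).congr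
      (Eventually.of_forall fun w => ?_)
    simp only
    rw [conj_kernel, mul_assoc, ← Complex.exp_add]
  refine ⟨fun z => ?_, fun z => ?_⟩
  · simp only [hconj]
    exact (RCLike.conjCLE (K := ℂ)).toContinuousLinearMap.integrable_comp (hi z)
  · rw [transform]
    simp only [hconj]
    rw [integral_conj, integral_mul_exp_conj (differentiable_conj_kernel s t z) a (hi z),
      Complex.conj_conj]

/-- The vector of the Fock space representing the functional `f ↦ T^{(s,t)} f(z)`. -/
noncomputable def kernelVec (s t : ℂ) (h : ‖t‖ < ‖s‖) (z : ℂ) : FockSpace :=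
  conj (1 / Complex.sqrt s * Complex.exp (t * z ^ 2 / (2 * s))) •
    gaussian (-t / conj s) (conj (z / s)) (norm_neg_div_conj_lt h)

theorem kernelVec_apply (s t : ℂ) (h : ‖t‖ < ‖s‖) (z w : ℂ) :
    kernelVec s t h z w = conj (kernel s t z w) :=
  (conj_kernel s t z w).symm

theorem inDomain (s t : ℂ) (h : ‖t‖ < ‖s‖) (f : FockSpace) : InDomain s t f := fun z => by
  have := integrable_conj_mul (kernelVec s t h z) f
  simpa only [kernelVec_apply, Complex.conj_conj] using this

theorem transform_eq_inner (s t : ℂ) (h : ‖t‖ < ‖s‖) (f : FockSpace) (z : ℂ) :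
    transform s t f z = inner ℂ (kernelVec s t h z) f := by
  rw [inner_eq_integral, transform]
  simp only [kernelVec_apply, Complex.conj_conj]

/-- The function `z ↦ K^{(s,t)}(z,a)`, the image of the coherent state at `a`. -/
noncomputable def kernelSection (s t : ℂ) (h : ‖t‖ < ‖s‖) (a : ℂ) : FockSpace :=
  (1 / Complex.sqrt s * Complex.exp (-(conj (t * a ^ 2) / (2 * s)))) •
    gaussian (t / s) (conj a / s) (norm_div_lt h)

theorem kernelSection_apply (s t : ℂ) (h : ‖t‖ < ‖s‖) (a z : ℂ) :
    kernelSection s t h a z = kernel s t z a := by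
  rw [kernelSection, smul_apply, gaussian_apply, mul_assoc, ← Complex.exp_add, kernel]
  congr 2
  ring

/-- A bound on the span of the coherent states extends to the whole Fock space. -/
theorem exists_isOperator {s t : ℂ} (h : ‖t‖ < ‖s‖) (C : ℝ)
    (hC : ∀ c : ℂ →₀ ℂ, ‖Finsupp.linearCombination ℂ (kernelSection s t h) c‖
      ≤ C * ‖Finsupp.linearCombination ℂ coherent c‖) :
    ∃ A : FockSpace →L[ℂ] FockSpace, IsOperator s t A := by
  set e := Finsupp.linearCombination ℂ coherent
  set g := Finsupp.linearCombination ℂ (kernelSection s t h)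
  refine ⟨g.extendOfNorm e, fun f => ⟨inDomain s t h f, fun z => ?_⟩⟩
  rw [transform_eq_inner s t h, ← inner_coherent]
  refine denseRange_linearCombination_coherent.induction_on
    (p := fun f => inner ℂ (coherent z) (g.extendOfNorm e f) = inner ℂ (kernelVec s t h z) f) f
    (isClosed_eq (by fun_prop) (by fun_prop)) fun c => ?_
  rw [LinearMap.extendOfNorm_eq denseRange_linearCombination_coherent ⟨C, hC⟩]
  simp only [g, Finsupp.linearCombination_apply, Finsupp.sum, inner_sum, inner_smul_right,
    inner_coherent, kernelSection_apply]
  refine Finset.sum_congr rfl fun a _ => ?_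
  rw [← inner_conj_symm (kernelVec s t h z), inner_coherent, kernelVec_apply, Complex.conj_conj]

theorem inner_kernelSection {s t : ℂ} (hD : ‖s‖ ^ 2 = ‖t‖ ^ 2 + 1) (h : ‖t‖ < ‖s‖) (b a : ℂ) :
    inner ℂ (kernelSection s t h b) (kernelSection s t h a) = inner ℂ (coherent b) (coherent a) := by
  have hs : 0 < ‖s‖ := (norm_nonneg t).trans_lt h
  have hs0 : s ≠ 0 := norm_pos_iff.1 hs
  have hcs0 : conj s ≠ 0 := (map_ne_zero _).2 hs0
  have h1 : 1 - ‖t / s‖ ^ 2 = (‖s‖ ^ 2)⁻¹ := by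
    rw [norm_div]
    field_simp
    linarith
  have h2 : (√(1 - ‖t / s‖ ^ 2))⁻¹ = ‖s‖ := by
    rw [h1, Real.sqrt_inv, inv_inv, Real.sqrt_sq hs.le]
  have h3 : conj (1 / Complex.sqrt s) * (1 / Complex.sqrt s) * ‖s‖ = 1 := by
    rw [Complex.conj_mul', norm_div, norm_one, norm_sqrt, ← Complex.ofReal_pow, div_pow,
      Real.sq_sqrt hs.le, ← Complex.ofReal_mul]
    norm_num [hs.ne']
  have hss : ((‖s‖ : ℂ)) ^ 2 = s * conj s := by
    rw [Complex.mul_conj, Complex.normSq_eq_norm_sq, Complex.ofReal_pow]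
  rw [inner_coherent, coherent_apply, kernelSection, kernelSection, inner_smul_left,
    inner_smul_right, inner_gaussian, h2, h1, map_mul, ← Complex.exp_conj]
  rw [show ∀ A B C D E F : ℂ, A * B * (C * D * (E * F)) = (A * C * E) * (B * D * F) by
    intros; ring, h3, one_mul, ← Complex.exp_add, ← Complex.exp_add]
  congr 1
  push_cast
  rw [hss]
  simp only [map_neg, map_mul, map_pow, map_div₀, map_ofNat, Complex.conj_conj]
  field_simp
  ring

theorem exists_isOperator_of_eq {s t : ℂ} (hD : ‖s‖ ^ 2 = ‖t‖ ^ 2 + 1) :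
    ∃ A : FockSpace →L[ℂ] FockSpace, IsOperator s t A := by
  have h : ‖t‖ < ‖s‖ := lt_of_pow_lt_pow_left₀ 2 (norm_nonneg s) (by linarith)
  refine exists_isOperator h 1 fun c => ?_
  rw [one_mul]
  refine le_of_eq ((pow_left_inj₀ (norm_nonneg _) (norm_nonneg _) two_ne_zero).1 ?_)
  rw [@norm_sq_eq_re_inner ℂ, @norm_sq_eq_re_inner ℂ]
  simp only [Finsupp.linearCombination_apply, Finsupp.sum, inner_sum, sum_inner, inner_smul_right,
    inner_smul_left, inner_kernelSection hD]

/-! ### The square integral of the kernel -/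

theorem norm_sq_kernelVec {s t : ℂ} (h : ‖t‖ < ‖s‖) (z : ℂ) :
    ((‖kernelVec s t h z‖ ^ 2 : ℝ) : ℂ) = ((√(‖s‖ ^ 2 - ‖t‖ ^ 2))⁻¹ : ℝ)
      * quadExp (-(1 / (‖s‖ ^ 2 - ‖t‖ ^ 2)))
          ((1 - 1 / (‖s‖ ^ 2 - ‖t‖ ^ 2) : ℝ) * (t / s)) 0 0 z := by
  have hs : 0 < ‖s‖ := (norm_nonneg t).trans_lt h
  have hD : 0 < ‖s‖ ^ 2 - ‖t‖ ^ 2 := by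
    have := pow_lt_pow_left₀ h (norm_nonneg t) two_ne_zero
    linarith
  have hs0 : s ≠ 0 := norm_pos_iff.1 hs
  have hcs0 : conj s ≠ 0 := (map_ne_zero _).2 hs0
  have h1 : 1 - ‖-t / conj s‖ ^ 2 = (‖s‖ ^ 2 - ‖t‖ ^ 2) / ‖s‖ ^ 2 := by
    rw [norm_div, norm_neg, RCLike.norm_conj]
    field_simp
  have h2 : (√(1 - ‖-t / conj s‖ ^ 2))⁻¹ = ‖s‖ * (√(‖s‖ ^ 2 - ‖t‖ ^ 2))⁻¹ := by
    rw [h1, Real.sqrt_div hD.le, Real.sqrt_sq hs.le, inv_div, div_eq_mul_inv]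
  have h3 : conj (1 / Complex.sqrt s) * (1 / Complex.sqrt s) * ‖s‖ = 1 := by
    rw [Complex.conj_mul', norm_div, norm_one, norm_sqrt, ← Complex.ofReal_pow, div_pow,
      Real.sq_sqrt hs.le, ← Complex.ofReal_mul]
    norm_num [hs.ne']
  have hss : ((‖s‖ : ℂ)) ^ 2 = s * conj s := by
    rw [Complex.mul_conj, Complex.normSq_eq_norm_sq, Complex.ofReal_pow]
  have hD0 : ((‖s‖ : ℂ)) ^ 2 - (‖t‖ : ℂ) ^ 2 ≠ 0 := by exact_mod_cast hD.ne'
  have hself : ((‖kernelVec s t h z‖ ^ 2 : ℝ) : ℂ)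
      = inner ℂ (kernelVec s t h z) (kernelVec s t h z) := by
    rw [inner_self_eq_norm_sq_to_K]
    push_cast
    rfl
  rw [hself, kernelVec, inner_smul_left, inner_smul_right, inner_gaussian, h2, h1,
    Complex.conj_conj, map_mul, ← Complex.exp_conj, quadExp]
  push_cast
  rw [show ∀ A B C D E F G : ℂ, A * B * (C * D * ((E * F) * G)) = (C * A * E) * (F * (B * D * G)) by
    intros; ring, h3, one_mul, ← Complex.exp_add, ← Complex.exp_add]
  congr 2
  set D : ℂ := (‖s‖ : ℂ) ^ 2 - (‖t‖ : ℂ) ^ 2 with hDdef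
  rw [hss]
  simp only [map_neg, map_sub, map_one, map_mul, map_pow, map_div₀, map_ofNat, Complex.conj_conj]
  have hDc : conj D = D := by
    simp [hDdef, Complex.conj_ofReal]
  simp only [hDc]
  field_simp
  ring

theorem integral_norm_sq_kernelVec {s t : ℂ} (hD : ‖t‖ ^ 2 + 1 < ‖s‖ ^ 2) (h : ‖t‖ < ‖s‖) :
    Integrable (fun z => ‖kernelVec s t h z‖ ^ 2) gaussianMeasure ∧
    ∫ z, ‖kernelVec s t h z‖ ^ 2 ∂gaussianMeasure = ‖s‖ / (‖s‖ ^ 2 - ‖t‖ ^ 2 - 1) := by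
  have hs : 0 < ‖s‖ := (norm_nonneg t).trans_lt h
  have hval := norm_sq_kernelVec (s := s) (t := t) h
  set D : ℝ := ‖s‖ ^ 2 - ‖t‖ ^ 2 with hDdef
  have hD1 : 1 < D := by linarith
  have hp : 0 < 1 - 1 / D := by
    rw [sub_pos, div_lt_one (by linarith)]
    exact hD1
  have hb : ‖((1 - 1 / D : ℝ) : ℂ) * (t / s)‖ = (1 - 1 / D) * (‖t‖ / ‖s‖) := by
    rw [norm_mul, Complex.norm_real, Real.norm_of_nonneg hp.le, norm_div]
  have hb1 : ‖((1 - 1 / D : ℝ) : ℂ) * (t / s)‖ < -(1 / D) + 1 := by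
    rw [hb]
    have : ‖t‖ / ‖s‖ < 1 := (div_lt_one hs).2 h
    nlinarith
  have hi := (integrable_quadExp_gaussianMeasure hb1 0 0).const_mul (((√D)⁻¹ : ℝ) : ℂ)
  have hI := integral_quadExp_gaussianMeasure hb1 0 0
  simp_rw [← hval] at hi
  refine ⟨by simpa only [RCLike.re_to_complex, Complex.ofReal_re] using hi.re, Complex.ofReal_injective ?_⟩
  rw [← integral_complex_ofReal]
  simp_rw [hval]
  rw [integral_const_mul, hI, hb]
  have hr : √((-(1 / D) + 1) ^ 2 - ((1 - 1 / D) * (‖t‖ / ‖s‖)) ^ 2) = (1 - 1 / D) * √D / ‖s‖ := by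
    rw [show (-(1 / D) + 1) ^ 2 - ((1 - 1 / D) * (‖t‖ / ‖s‖)) ^ 2
      = ((1 - 1 / D) / ‖s‖) ^ 2 * D by
        field_simp
        rw [hDdef]
        ring, Real.sqrt_mul (by positivity), Real.sqrt_sq (by positivity)]
    ring
  rw [hr]
  have hsq : √D * √D = D := Real.mul_self_sqrt (by linarith)
  have hsD : 0 < √D := Real.sqrt_pos.2 (by linarith)
  have hfin : (√D)⁻¹ * ((1 - 1 / D) * √D / ‖s‖)⁻¹ = ‖s‖ / (D - 1) := by
    have hD0 : D ≠ 0 := by linarith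
    have hD2 : D - 1 ≠ 0 := by linarith
    rw [show (1 - 1 / D) = (D - 1) / D by field_simp]
    field_simp
    linear_combination -hsq
  rw [← hfin]
  simp

end Fock

namespace Fock

open ComplexConjugate FockSpace

theorem exists_isOperator_of_lt {s t : ℂ} (hD : ‖t‖ ^ 2 + 1 < ‖s‖ ^ 2) :
    ∃ A : FockSpace →L[ℂ] FockSpace, IsOperator s t A := by
  have h : ‖t‖ < ‖s‖ := lt_of_pow_lt_pow_left₀ 2 (norm_nonneg s) (by linarith)
  have hi := (integral_norm_sq_kernelVec hD h).1
  refine exists_isOperator h (√(∫ z, ‖kernelVec s t h z‖ ^ 2 ∂gaussianMeasure)) fun c => ?_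
  set f := Finsupp.linearCombination ℂ coherent c with hf
  set g := Finsupp.linearCombination ℂ (kernelSection s t h) c with hg
  have hgf : ∀ z, g z = inner ℂ (kernelVec s t h z) f := fun z => by
    rw [← inner_coherent]
    simp only [hf, hg, Finsupp.linearCombination_apply, Finsupp.sum, inner_sum, inner_smul_right,
      inner_coherent, kernelSection_apply]
    refine Finset.sum_congr rfl fun a _ => ?_
    rw [← inner_conj_symm (kernelVec s t h z), inner_coherent, kernelVec_apply, Complex.conj_conj]
  refine le_of_sq_le_sq ?_ (by positivity)
  rw [mul_pow, Real.sq_sqrt (integral_nonneg fun z => by positivity), norm_sq_eq_integral,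
    ← integral_mul_const]
  refine integral_mono g.integrable_norm_sq (hi.mul_const _) fun z => ?_
  simp only
  rw [hgf, ← mul_pow]
  gcongr
  exact norm_inner_le_norm _ _

theorem exists_isOperator_of_le {s t : ℂ} (hD : ‖t‖ ^ 2 + 1 ≤ ‖s‖ ^ 2) :
    ∃ A : FockSpace →L[ℂ] FockSpace, IsOperator s t A := by
  rcases hD.lt_or_eq with h | h
  · exact exists_isOperator_of_lt h
  · exact exists_isOperator_of_eq h.symm

theorem IsOperator.isBounded {s t : ℂ} {A : FockSpace →L[ℂ] FockSpace} (hA : IsOperator s t A) :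
    IsBounded s t :=
  ⟨‖A‖, fun f _ => ⟨A f, (hA f).2, A.le_opNorm f⟩⟩

/-! ### Necessity -/

/-- Boundedness on coherent states bounds the kernel pointwise. -/
theorem IsBounded.norm_kernel_le {s t : ℂ} (hst : ‖t‖ < 2 * ‖s‖) (hB : IsBounded s t) :
    ∃ C : ℝ, ∀ z a, ‖kernel s t z a‖ ≤ C * Real.exp ((‖z‖ ^ 2 + ‖a‖ ^ 2) / 2) := by
  obtain ⟨C, hC⟩ := hB
  refine ⟨C, fun z a => ?_⟩
  obtain ⟨hdom, hval⟩ := integrable_and_transform_coherent hst a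
  obtain ⟨g, hg, hgC⟩ := hC (coherent a) hdom
  have h := norm_apply_le g z
  rw [hg, hval] at h
  refine h.trans ?_
  rw [norm_coherent] at hgC
  rw [add_div, Real.exp_add]
  nlinarith [Real.exp_pos (‖z‖ ^ 2 / 2)]

/-- The direction in which the kernel grows fastest. -/
theorem exists_kernel_exponent_eq (s t : ℂ) (hs : s ≠ 0) : ∃ z a : ℂ, a ≠ 0 ∧
    (t * z ^ 2 - conj (t * a ^ 2) + 2 * z * conj a) / s
      = (√(1 + ‖t‖ ^ 2) / ‖s‖ * (‖z‖ ^ 2 + ‖a‖ ^ 2) : ℝ) := by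
  set m : ℝ := √(1 + ‖t‖ ^ 2)
  have hm : 0 < m := Real.sqrt_pos.2 (by positivity)
  have hm0 : (m : ℂ) ≠ 0 := by exact_mod_cast hm.ne'
  have hm2 : (m : ℂ) ^ 2 = 1 + t * conj t := by
    rw [Complex.mul_conj, Complex.normSq_eq_norm_sq]
    exact_mod_cast Real.sq_sqrt (by positivity)
  have hns : ((‖s‖ : ℂ)) ≠ 0 := by exact_mod_cast (norm_pos_iff.2 hs).ne'
  have hns2 : ((‖s‖ : ℂ)) ^ 2 = s * conj s := by
    rw [Complex.mul_conj, Complex.normSq_eq_norm_sq, Complex.ofReal_pow]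
  set p : ℂ := ‖s‖ / (s * m)
  have hp0 : p ≠ 0 := div_ne_zero hns (mul_ne_zero hs hm0)
  have hps : p * s * m = ‖s‖ := by
    simp only [p]
    field_simp
  have hpp : p * conj p * m ^ 2 = 1 := by
    have hcs : conj s ≠ 0 := (map_ne_zero _).2 hs
    simp only [p, map_div₀, map_mul, Complex.conj_ofReal]
    field_simp
    rw [hns2]
  have hsinv : s⁻¹ = p * m / ‖s‖ := by
    rw [← hps]
    field_simp
  have hmain : p * (t * (1 + conj p * conj t) ^ 2 - conj t * conj p ^ 2
      + 2 * (1 + conj p * conj t) * conj p) = (1 + conj p * conj t) * (1 + p * t) + p * conj p := by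
    linear_combination (1 + conj p * conj t) * (hpp - p * conj p * hm2)
  refine ⟨1 + conj (p * t), p, hp0, ?_⟩
  push_cast
  rw [← Complex.mul_conj', ← Complex.mul_conj', div_eq_mul_inv, hsinv]
  simp only [map_add, map_mul, map_pow, map_one, Complex.conj_conj]
  linear_combination m / ‖s‖ * hmain

theorem IsBounded.le {s t : ℂ} (hst : ‖t‖ < 2 * ‖s‖) (hB : IsBounded s t) :
    ‖t‖ ^ 2 + 1 ≤ ‖s‖ ^ 2 := by
  have hs : 0 < ‖s‖ := by linarith [norm_nonneg t]
  obtain ⟨C, hC⟩ := hB.norm_kernel_le hst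
  obtain ⟨z, a, ha, hza⟩ := exists_kernel_exponent_eq s t (norm_pos_iff.1 hs)
  by_contra hlt
  rw [not_le] at hlt
  set N : ℝ := ‖z‖ ^ 2 + ‖a‖ ^ 2
  have hN : 0 < N := by positivity
  set κ : ℝ := √(1 + ‖t‖ ^ 2) / ‖s‖
  have hκ : 1 < κ := (one_lt_div hs).2 (Real.lt_sqrt_of_sq_lt (by linarith))
  have hbound : ∀ R : ℝ, Real.exp ((κ - 1) * N / 2 * R ^ 2) ≤ C * √‖s‖ := fun R => by
    have h := hC (R * z) (R * a)
    have hexp : (t * (R * z) ^ 2 - conj (t * (R * a) ^ 2) + 2 * (R * z) * conj (R * a)) / (2 * s)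
        = ((R ^ 2 * (κ * N) / 2 : ℝ) : ℂ) := by
      have : (t * (R * z) ^ 2 - conj (t * (R * a) ^ 2) + 2 * (R * z) * conj (R * a)) / (2 * s)
          = R ^ 2 * ((t * z ^ 2 - conj (t * a ^ 2) + 2 * z * conj a) / s) / 2 := by
        simp only [map_mul, map_pow, Complex.conj_ofReal]
        field_simp
      rw [this, hza]
      push_cast
      rfl
    rw [norm_kernel, hexp, Complex.ofReal_re, norm_mul, norm_mul, Complex.norm_real,
      Real.norm_eq_abs, mul_pow, mul_pow, sq_abs, ← mul_add, inv_mul_le_iff₀ (by positivity)] at h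
    have hsplit : Real.exp (R ^ 2 * (κ * N) / 2)
        = Real.exp ((κ - 1) * N / 2 * R ^ 2) * Real.exp (R ^ 2 * N / 2) := by
      rw [← Real.exp_add]
      congr 1
      ring
    rw [hsplit] at h
    refine le_of_mul_le_mul_right (h.trans (le_of_eq ?_)) (Real.exp_pos (R ^ 2 * N / 2))
    ring
  have hpos : 0 < (κ - 1) * N / 2 := by
    have : 0 < κ - 1 := by linarith
    positivity
  have htend : Tendsto (fun R : ℝ => Real.exp ((κ - 1) * N / 2 * R ^ 2)) atTop atTop :=
    Real.tendsto_exp_atTop.comp ((tendsto_pow_atTop two_ne_zero).const_mul_atTop hpos)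
  obtain ⟨R, hR⟩ := (htend.eventually_gt_atTop (C * √‖s‖)).exists
  exact (hbound R).not_gt hR

/-! ### The unitary case -/

theorem IsOperator.apply_eq_inner {s t : ℂ} {A : FockSpace →L[ℂ] FockSpace}
    (hA : IsOperator s t A) (h : ‖t‖ < ‖s‖) (f : FockSpace) (z : ℂ) :
    A f z = inner ℂ (kernelVec s t h z) f := by
  rw [(hA f).2, transform_eq_inner s t h]

theorem IsOperator.apply_coherent {s t : ℂ} {A : FockSpace →L[ℂ] FockSpace}
    (hA : IsOperator s t A) (h : ‖t‖ < ‖s‖) (a : ℂ) : A (coherent a) = kernelSection s t h a :=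
  ext_apply fun z => by
    rw [hA.apply_eq_inner h, kernelSection_apply, ← inner_conj_symm, inner_coherent,
      kernelVec_apply, Complex.conj_conj]

theorem IsOperator.adjoint_apply {s t : ℂ} {A : FockSpace →L[ℂ] FockSpace}
    (hA : IsOperator s t A) (h : ‖t‖ < ‖s‖) (f : FockSpace) (a : ℂ) :
    ContinuousLinearMap.adjoint A f a = inner ℂ (kernelSection s t h a) f := by
  rw [← inner_coherent, ContinuousLinearMap.adjoint_inner_right, hA.apply_coherent h]

theorem IsOperator.adjoint_eq {s t : ℂ} {A B : FockSpace →L[ℂ] FockSpace}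
    (hA : IsOperator s t A) (hB : IsOperator (conj s) (-t) B) (h : ‖t‖ < ‖s‖) :
    ContinuousLinearMap.adjoint A = sign s • B := by
  have h' : ‖-t‖ < ‖conj s‖ := by rwa [norm_neg, RCLike.norm_conj]
  have hs : s ≠ 0 := norm_pos_iff.1 ((norm_nonneg t).trans_lt h)
  refine ContinuousLinearMap.ext fun f => ext_apply fun a => ?_
  have hvec : kernelSection s t h a = sign s • kernelVec (conj s) (-t) h' a := ext_apply fun z => by
    rw [kernelSection_apply, smul_apply, kernelVec_apply, kernel_conj_neg s t hs, map_mul,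
      Complex.conj_conj, conj_sign, ← mul_assoc, sign_mul_sign, one_mul]
  rw [hA.adjoint_apply h, hvec, inner_smul_left, conj_sign, ← hB.apply_eq_inner h']
  rfl

theorem IsOperator.adjoint_comp_self {s t : ℂ} {A : FockSpace →L[ℂ] FockSpace}
    (hA : IsOperator s t A) (hD : ‖s‖ ^ 2 = ‖t‖ ^ 2 + 1) :
    ContinuousLinearMap.adjoint A ∘L A = ContinuousLinearMap.id ℂ FockSpace := by
  have h : ‖t‖ < ‖s‖ := lt_of_pow_lt_pow_left₀ 2 (norm_nonneg s) (by linarith)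
  refine ContinuousLinearMap.ext fun f => ?_
  refine denseRange_linearCombination_coherent.induction_on
    (p := fun f => (ContinuousLinearMap.adjoint A ∘L A) f = f) f
    (isClosed_eq (by fun_prop) (by fun_prop)) fun c => ?_
  have hcoh : ∀ a, (ContinuousLinearMap.adjoint A ∘L A) (coherent a) = coherent a := fun a =>
    ext_apply fun b => by
      rw [ContinuousLinearMap.comp_apply, hA.adjoint_apply h, hA.apply_coherent h,
        inner_kernelSection hD, inner_coherent]
  simp only [Finsupp.linearCombination_apply, Finsupp.sum, map_sum, map_smul, hcoh]

theorem unitary_identities {s t : ℂ} (hD : ‖s‖ ^ 2 = ‖t‖ ^ 2 + 1)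
    {A B : FockSpace →L[ℂ] FockSpace} (hA : IsOperator s t A) (hB : IsOperator (conj s) (-t) B) :
    A ∘L (sign s • B) = ContinuousLinearMap.id ℂ FockSpace ∧
      (sign s • B) ∘L A = ContinuousLinearMap.id ℂ FockSpace ∧
      ContinuousLinearMap.adjoint A = sign s • B := by
  have h : ‖t‖ < ‖s‖ := lt_of_pow_lt_pow_left₀ 2 (norm_nonneg s) (by linarith)
  have hadj := hA.adjoint_eq hB h
  have hAA := hA.adjoint_comp_self hD
  have hBB := hB.adjoint_comp_self (by rwa [norm_neg, RCLike.norm_conj])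
  have hA' : A = sign s • ContinuousLinearMap.adjoint B := by
    rw [← ContinuousLinearMap.adjoint_adjoint A, hadj, map_smulₛₗ, conj_sign]
  refine ⟨?_, hadj ▸ hAA, hadj⟩
  nth_rewrite 1 [hA']
  rw [ContinuousLinearMap.smul_comp, ContinuousLinearMap.comp_smul, smul_smul, hBB, sign_mul_sign,
    one_smul]

theorem eq_of_isOperator_of_unitary {s t : ℂ} (hst : ‖t‖ < 2 * ‖s‖)
    {A : FockSpace →L[ℂ] FockSpace} (hA : IsOperator s t A)
    (hU : A ∈ unitary (FockSpace →L[ℂ] FockSpace)) : ‖s‖ ^ 2 = ‖t‖ ^ 2 + 1 := by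
  have hle := hA.isBounded.le hst
  have h : ‖t‖ < ‖s‖ := lt_of_pow_lt_pow_left₀ 2 (norm_nonneg s) (by linarith)
  have hAA' : A ∘L ContinuousLinearMap.adjoint A = ContinuousLinearMap.id ℂ FockSpace := hU.2
  have hvec : ContinuousLinearMap.adjoint A (coherent 0) = kernelVec s t h 0 := by
    refine ext_inner_right ℂ fun f => ?_
    rw [ContinuousLinearMap.adjoint_inner_left, inner_coherent, hA.apply_eq_inner h]
  have hnorm : ‖kernelVec s t h 0‖ ^ 2 = 1 := by
    rw [← hvec, @norm_sq_eq_re_inner ℂ, ContinuousLinearMap.adjoint_inner_left,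
      ← ContinuousLinearMap.comp_apply, hAA', ContinuousLinearMap.id_apply,
      ← @norm_sq_eq_re_inner ℂ, norm_coherent]
    simp
  have hv := norm_sq_kernelVec h 0
  rw [hnorm, quadExp] at hv
  simp only [map_zero, mul_zero, ne_eq, OfNat.ofNat_ne_zero, not_false_eq_true, zero_pow, add_zero,
    neg_zero, zero_div, Complex.exp_zero, mul_one] at hv
  have h1 : (√(‖s‖ ^ 2 - ‖t‖ ^ 2))⁻¹ = 1 := (Complex.ofReal_injective hv).symm
  rw [inv_eq_one, Real.sqrt_eq_one] at h1
  linarith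

/-! ### The Hilbert-Schmidt norm -/

theorem hasSum_norm_sq_inner {ι : Type*} (b : HilbertBasis ι ℂ FockSpace) (x : FockSpace) :
    HasSum (fun i => ‖(inner ℂ x (b i) : ℂ)‖ ^ 2) (‖x‖ ^ 2) := by
  have h := RCLike.hasSum_re ℂ (b.hasSum_inner_mul_inner x x)
  rw [← norm_sq_eq_re_inner] at h
  refine h.congr_fun fun i => ?_
  rw [← inner_conj_symm (b i) x, Complex.mul_conj, Complex.normSq_eq_norm_sq]
  exact (Complex.ofReal_re _).symm

theorem IsOperator.hasHilbertSchmidtNorm {s t : ℂ} {A : FockSpace →L[ℂ] FockSpace}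
    (hA : IsOperator s t A) (hD : ‖t‖ ^ 2 + 1 < ‖s‖ ^ 2) :
    HasHilbertSchmidtNorm A (√‖s‖ / √(‖s‖ ^ 2 - ‖t‖ ^ 2 - 1)) := by
  have h : ‖t‖ < ‖s‖ := lt_of_pow_lt_pow_left₀ 2 (norm_nonneg s) (by linarith)
  obtain ⟨hi, hI⟩ := integral_norm_sq_kernelVec hD h
  refine ⟨by positivity, fun ι b => ?_⟩
  have : Countable ι := countable_of_hilbertBasis b
  rw [div_pow, Real.sq_sqrt (norm_nonneg s), Real.sq_sqrt (by linarith), ← hI]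
  have hpt : ∀ z, HasSum (fun i => ‖A (b i) z‖ ^ 2) (‖kernelVec s t h z‖ ^ 2) := fun z => by
    simp_rw [hA.apply_eq_inner h]
    exact hasSum_norm_sq_inner b _
  have hsum : Summable fun i => ∫ z, ‖‖A (b i) z‖ ^ 2‖ ∂gaussianMeasure := by
    refine summable_of_sum_le (c := ∫ z, ‖kernelVec s t h z‖ ^ 2 ∂gaussianMeasure)
      (fun i => integral_nonneg fun z => norm_nonneg _) fun u => ?_
    simp only [norm_pow, norm_norm]
    rw [← integral_finsetSum _ fun i _ => (A (b i)).integrable_norm_sq]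
    refine integral_mono (integrable_finsetSum _ fun i _ => (A (b i)).integrable_norm_sq) hi
      fun z => ?_
    exact sum_le_hasSum u (fun i _ => by positivity) (hpt z)
  have hfin := hasSum_integral_of_summable_integral_norm
    (fun i => (A (b i)).integrable_norm_sq) hsum
  simp only [(hpt _).tsum_eq] at hfin
  simpa only [norm_sq_eq_integral] using hfin

end Fock

theorem theoremA (s t : ℂ) (hst : ‖t‖ < 2 * ‖s‖) :
    ((Fock.IsBounded s t ↔ ‖t‖ ^ 2 + 1 ≤ ‖s‖ ^ 2) ∧
      (‖t‖ ^ 2 + 1 ≤ ‖s‖ ^ 2 → ∃ A : FockSpace →L[ℂ] FockSpace, Fock.IsOperator s t A)) ∧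
    ((∃ A : FockSpace →L[ℂ] FockSpace,
        Fock.IsOperator s t A ∧ A ∈ unitary (FockSpace →L[ℂ] FockSpace)) ↔
      ‖s‖ ^ 2 = ‖t‖ ^ 2 + 1) ∧
    (‖s‖ ^ 2 = ‖t‖ ^ 2 + 1 →
      ∃ A B : FockSpace →L[ℂ] FockSpace,
        Fock.IsOperator s t A ∧ Fock.IsOperator ((starRingEnd ℂ) s) (-t) B ∧
        A ∘L (Fock.sign s • B) = ContinuousLinearMap.id ℂ FockSpace ∧
        (Fock.sign s • B) ∘L A = ContinuousLinearMap.id ℂ FockSpace ∧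
        ContinuousLinearMap.adjoint A = Fock.sign s • B) ∧
    (‖t‖ ^ 2 + 1 < ‖s‖ ^ 2 →
      ∃ A : FockSpace →L[ℂ] FockSpace, Fock.IsOperator s t A ∧
        Fock.HasHilbertSchmidtNorm A (√‖s‖ / √(‖s‖ ^ 2 - ‖t‖ ^ 2 - 1))) := by
  have hAB : ‖s‖ ^ 2 = ‖t‖ ^ 2 + 1 → ∃ A B : FockSpace →L[ℂ] FockSpace,
      Fock.IsOperator s t A ∧ Fock.IsOperator ((starRingEnd ℂ) s) (-t) B ∧
      A ∘L (Fock.sign s • B) = ContinuousLinearMap.id ℂ FockSpace ∧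
      (Fock.sign s • B) ∘L A = ContinuousLinearMap.id ℂ FockSpace ∧
      ContinuousLinearMap.adjoint A = Fock.sign s • B := fun hD => by
    obtain ⟨A, hA⟩ := Fock.exists_isOperator_of_eq hD
    obtain ⟨B, hB⟩ := Fock.exists_isOperator_of_eq (s := (starRingEnd ℂ) s) (t := -t)
      (by rwa [norm_neg, RCLike.norm_conj])
    exact ⟨A, B, hA, hB, Fock.unitary_identities hD hA hB⟩
  refine ⟨⟨⟨fun hB => hB.le hst, fun hD => ?_⟩, Fock.exists_isOperator_of_le⟩,
    ⟨fun ⟨A, hA, hU⟩ => Fock.eq_of_isOperator_of_unitary hst hA hU, fun hD => ?_⟩, hAB,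
    fun hD => ?_⟩
  · obtain ⟨A, hA⟩ := Fock.exists_isOperator_of_le hD
    exact hA.isBounded
  · obtain ⟨A, B, hA, -, h1, h2, h3⟩ := hAB hD
    refine ⟨A, hA, Unitary.mem_iff.2 ⟨?_, ?_⟩⟩
    · rw [ContinuousLinearMap.star_eq_adjoint, h3]
      exact h2
    · rw [ContinuousLinearMap.star_eq_adjoint, h3]
      exact h1
  · obtain ⟨A, hA⟩ := Fock.exists_isOperator_of_lt hD
    exact ⟨A, hA, hA.hasHilbertSchmidtNorm hD⟩
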